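/- A Boolean function family is a sequence $f=(f_n)_{n\ge 0}$ with $f_n:\{0,1\}^n\to\{0,1\}$. $\mathsf{AC}^0$ is the (nonuniform) class of families computed by Boolean circuits of constant depth and size polynomial in $n$, with NOT gates and AND and OR gates of unbounded fan-in; a circuit is monotone if it has no NOT gate. A randomized monotone decision tree on $n$ variables is a finite rooted binary tree whose leaves are labelled $0$ or $1$ and whose internal nodes each have two outgoing edges, labelled $0$ and $1$; each internal node either carries a monotone function $q:\{0,1\}^n\to\{0,1\}$ (a query node) or is a random node. On input $x$ the computation starts at the root; at a query node it follows the edge labelled $q(x)$, and at a random node it follows the edge given by an independent fair coin. The tree computes $g:\{0,1\}^n\to\{0,1\}$ if, for every $x\in\{0,1\}^n$, the computation reaches a leaf labelled $g(x)$ with probability at least $2/3$. Its height is the maximum number of internal nodes (of both kinds) on a path from the root to a leaf. Let $\mathrm{RMDT}(\mathsf{AC}^0)$ be the class of families $(f_n)$ for which there are randomized monotone decision trees $T_n$ computing $f_n$, of height $O(\log n)$, such that for some polynomial $p$ and constant $d$, every function queried in any $T_n$ has a monotone circuit, with unbounded fan-in AND and OR gates, of size at most $p(n)$ and depth at most $d$.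 **Theorem.** $\mathrm{RMDT}(\mathsf{AC}^0)\subseteq \mathsf{AC}^0$. -/

import Mathlib

/-- A family of Boolean functions, one function `{0,1}ⁿ → {0,1}` for every number `n` of
variables. -/
abbrev BoolFamily : Type := (n : ℕ) → (Fin n → Bool) → Bool

/-- A gate of a circuit on `n` variables which is preceded by `i` other gates. A wire into the gate
comes from an input variable (`Sum.inl`) or from a preceding gate (`Sum.inr`). AND and OR gates
have unbounded fan-in; fan-in `0` gives the constants `1` (AND) and `0` (OR). -/
inductive Gate (n i : ℕ) : Type
  | and (S : Finset (Fin n ⊕ Fin i)) : Gate n i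
  | or (S : Finset (Fin n ⊕ Fin i)) : Gate n i
  | not (w : Fin n ⊕ Fin i) : Gate n i

namespace Gate

/-- The value of a gate, given the input `x` and the values `v` of the preceding gates. -/
def eval {n i : ℕ} (x : Fin n → Bool) (v : Fin i → Bool) : Gate n i → Bool
  | and S => decide (∀ w ∈ S, Sum.elim x v w = true)
  | or S => decide (∃ w ∈ S, Sum.elim x v w = true)
  | not w => !(Sum.elim x v w)

/-- The depth of a gate, given the depths `v` of the preceding gates (inputs have depth `0`). -/
def depth {n i : ℕ} (v : Fin i → ℕ) : Gate n i → ℕ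
  | and S => S.sup (Sum.elim (fun _ => 0) v) + 1
  | or S => S.sup (Sum.elim (fun _ => 0) v) + 1
  | not w => Sum.elim (fun _ => 0) v w + 1

/-- A gate is monotone if it is not a negation. -/
def IsMonotone {n i : ℕ} : Gate n i → Prop
  | and _ => True
  | or _ => True
  | not _ => False

end Gate

/-- A Boolean circuit on `n` variables: a directed acyclic graph of gates, listed in a topological
order, with one designated output, which is an input variable or a gate. -/
structure Circuit (n : ℕ) where
  /-- the number of gates -/
  size : ℕ
  /-- the gates, each one reading input variables and earlier gates -/
  gate : (i : Fin size) → Gate n i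
  /-- the output of the circuit -/
  output : Fin n ⊕ Fin size

namespace Circuit

/-- The value of the `i`-th gate on input `x`. -/
def gateVal {n : ℕ} (C : Circuit n) (x : Fin n → Bool) (i : Fin C.size) : Bool :=
  (C.gate i).eval x fun j : Fin i => C.gateVal x ⟨j, j.2.trans i.2⟩
termination_by i.val
decreasing_by exact j.2

/-- The output bit of the circuit on input `x`. -/
def eval {n : ℕ} (C : Circuit n) (x : Fin n → Bool) : Bool :=
  Sum.elim x (C.gateVal x) C.output

/-- The depth of the `i`-th gate: the largest number of gates on a path that ends in it. -/
def gateDepth {n : ℕ} (C : Circuit n) (i : Fin C.size) : ℕ :=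
  (C.gate i).depth fun j : Fin i => C.gateDepth ⟨j, j.2.trans i.2⟩
termination_by i.val
decreasing_by exact j.2

/-- The depth of the circuit: the largest number of gates on a path that ends in the output. -/
def depth {n : ℕ} (C : Circuit n) : ℕ :=
  Sum.elim (fun _ => 0) C.gateDepth C.output

/-- A circuit is monotone if it has no negation gates. -/
def IsMonotone {n : ℕ} (C : Circuit n) : Prop :=
  ∀ i, (C.gate i).IsMonotone

/-- The circuit computes the Boolean function `f`. -/
def Computes {n : ℕ} (C : Circuit n) (f : (Fin n → Bool) → Bool) : Prop :=
  ∀ x, C.eval x = f x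

end Circuit

/-- (Nonuniform) `AC⁰`: families computed by circuits of polynomial size and constant depth over
unbounded fan-in AND and OR gates and NOT gates. -/
def AC0 : Set BoolFamily :=
  {f | ∃ (p : Polynomial ℕ) (d : ℕ), ∀ n, ∃ C : Circuit n,
    C.size ≤ p.eval n ∧ C.depth ≤ d ∧ C.Computes (f n)}

/-- A randomized monotone decision tree on `n` variables. An internal node either queries a monotone
function or flips a fair coin; `t₀` is the subtree along the edge labelled `0`, and `t₁` the one
along the edge labelled `1`. -/
inductive RMDTree (n : ℕ) : Type
  | leaf (b : Bool) : RMDTree n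
  | query (q : (Fin n → Bool) → Bool) (hq : Monotone q) (t₀ t₁ : RMDTree n) : RMDTree n
  | random (t₀ t₁ : RMDTree n) : RMDTree n

namespace RMDTree

/-- The distribution of the label of the leaf that the computation on input `x` reaches. -/
noncomputable def outcome {n : ℕ} (x : Fin n → Bool) : RMDTree n → PMF Bool
  | leaf b => PMF.pure b
  | query q _ t₀ t₁ => if q x = true then t₁.outcome x else t₀.outcome x
  | random t₀ t₁ =>
      (PMF.uniformOfFintype Bool).bind fun r =>
        if r = true then t₁.outcome x else t₀.outcome x

/-- The height: the largest number of internal nodes (of both kinds) on a path from the root to a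
leaf. -/
def height {n : ℕ} : RMDTree n → ℕ
  | leaf _ => 0
  | query _ _ t₀ t₁ => max t₀.height t₁.height + 1
  | random t₀ t₁ => max t₀.height t₁.height + 1

/-- The set of functions that are queried in the tree. -/
def queries {n : ℕ} : RMDTree n → Set ((Fin n → Bool) → Bool)
  | leaf _ => ∅
  | query q _ t₀ t₁ => {q} ∪ t₀.queries ∪ t₁.queries
  | random t₀ t₁ => t₀.queries ∪ t₁.queries

/-- The tree computes `f`: on every input `x`, a leaf with label `f x` is reached with probability
at least `2/3`. -/
def Computes {n : ℕ} (T : RMDTree n) (f : (Fin n → Bool) → Bool) : Prop :=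
  ∀ x, 2 / 3 ≤ T.outcome x (f x)

end RMDTree

/-- `RMDT(AC⁰)`: families computed by randomized monotone decision trees of height `O(log n)`, all
of whose queries have monotone circuits of polynomial size and constant depth (the polynomial and
the depth bound being common to all queries and all `n`). -/
def RMDT_AC0 : Set BoolFamily :=
  {f | ∃ T : (n : ℕ) → RMDTree n,
    (∀ n, (T n).Computes (f n)) ∧
    ((fun n : ℕ => ((T n).height : ℝ)) =O[Filter.atTop] fun n : ℕ => Real.log n) ∧
    ∃ (p : Polynomial ℕ) (d : ℕ), ∀ n, ∀ q ∈ (T n).queries, ∃ C : Circuit n,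
      C.IsMonotone ∧ C.size ≤ p.eval n ∧ C.depth ≤ d ∧ C.Computes q}

/-! Once its coins are fixed, a tree of height `h` is an OR, over its accepting paths, of ANDs of at
most `h` queries or negated queries. Since `h = O(log n)`, this is a polynomial-size constant-depth
circuit (`exists_dnf_family`). The randomized tree is thus a uniform mixture of such DNFs, each
agreeing with `f` at any given input with probability at least 2/3.

The coins are removed nonuniformly by approximate majority: independent samples are combined by an
AND of `n + 1` ORs of `2 ^ t` ANDs of `t` samples, with `t` of order `log n`. The error at each
input is below `2 ^ (-n)`, so by the union bound one choice of samples is right on all `2 ^ n`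
inputs (`exists_samples`). The three new layers keep depth constant and size polynomial. -/

/-! ### Embedding and gluing of circuits. -/

namespace Gate

/-- Rename the preceding gates that a gate reads. -/
def map {n i k : ℕ} (g : Fin i → Fin k) : Gate n i → Gate n k
  | and S => and (S.image (Sum.map id g))
  | or S => or (S.image (Sum.map id g))
  | not w => not (Sum.map id g w)

theorem eval_map {n i k : ℕ} (g : Fin i → Fin k) (x : Fin n → Bool) (v : Fin k → Bool)
    (G : Gate n i) : (G.map g).eval x v = G.eval x (v ∘ g) := by
  cases G <;> simp [map, eval, Sum.elim_map]

theorem depth_map {n i k : ℕ} (g : Fin i → Fin k) (v : Fin k → ℕ) (G : Gate n i) :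
    (G.map g).depth v = G.depth (v ∘ g) := by
  cases G <;> simp [map, depth, Sum.elim_map, Finset.sup_image, Function.comp_def]

end Gate

namespace Circuit

variable {n : ℕ}

/-- The value carried by a wire. -/
def wireVal (C : Circuit n) (x : Fin n → Bool) (w : Fin n ⊕ Fin C.size) : Bool :=
  Sum.elim x (C.gateVal x) w

/-- The depth of a wire. -/
def wireDepth (C : Circuit n) (w : Fin n ⊕ Fin C.size) : ℕ :=
  Sum.elim (fun _ => 0) C.gateDepth w

/-- `φ` embeds the gates of `C` as gates of `E`, compatibly with the wiring. -/
def IsEmbedding (C E : Circuit n) (φ : Fin C.size → Fin E.size) : Prop :=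
  ∀ i : Fin C.size, ∃ g : Fin i → Fin (φ i),
    (∀ j : Fin i, (g j : ℕ) = φ ⟨j, j.2.trans i.2⟩) ∧ E.gate (φ i) = (C.gate i).map g

theorem IsEmbedding.gateVal {C E : Circuit n} {φ : Fin C.size → Fin E.size}
    (h : C.IsEmbedding E φ) (x : Fin n → Bool) (i : Fin C.size) :
    E.gateVal x (φ i) = C.gateVal x i := by
  obtain ⟨i, hi⟩ := i
  induction i using Nat.strong_induction_on with
  | _ i ih =>
    obtain ⟨g, hg, hE⟩ := h ⟨i, hi⟩
    rw [Circuit.gateVal, hE, Gate.eval_map, Circuit.gateVal]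
    congr 1
    funext j
    rw [← ih j j.2 (j.2.trans hi)]
    simp only [Function.comp]
    congr 1
    exact Fin.ext (hg j)

theorem IsEmbedding.gateDepth {C E : Circuit n} {φ : Fin C.size → Fin E.size}
    (h : C.IsEmbedding E φ) (i : Fin C.size) : E.gateDepth (φ i) = C.gateDepth i := by
  obtain ⟨i, hi⟩ := i
  induction i using Nat.strong_induction_on with
  | _ i ih =>
    obtain ⟨g, hg, hE⟩ := h ⟨i, hi⟩
    rw [Circuit.gateDepth, hE, Gate.depth_map, Circuit.gateDepth]
    congr 1
    funext j
    rw [← ih j j.2 (j.2.trans hi)]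
    simp only [Function.comp]
    congr 1
    exact Fin.ext (hg j)

theorem IsEmbedding.wireVal {C E : Circuit n} {φ : Fin C.size → Fin E.size}
    (h : C.IsEmbedding E φ) (x : Fin n → Bool) (w : Fin n ⊕ Fin C.size) :
    E.wireVal x (Sum.map id φ w) = C.wireVal x w := by
  cases w <;> simp [Circuit.wireVal, h.gateVal]

theorem IsEmbedding.wireDepth {C E : Circuit n} {φ : Fin C.size → Fin E.size}
    (h : C.IsEmbedding E φ) (w : Fin n ⊕ Fin C.size) :
    E.wireDepth (Sum.map id φ w) = C.wireDepth w := by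
  cases w <;> simp [Circuit.wireDepth, h.gateDepth]

/-- The circuits `C` and `D` side by side, with the output of `D`. -/
def append (C D : Circuit n) : Circuit n where
  size := C.size + D.size
  gate i :=
    if h : (i : ℕ) < C.size then C.gate ⟨i, h⟩
    else (D.gate ⟨i - C.size, by omega⟩).map fun j => ⟨C.size + j, by
      have := j.2
      simp only at this
      omega⟩
  output := Sum.map id (Fin.natAdd C.size) D.output

theorem isEmbedding_append_left (C D : Circuit n) :
    C.IsEmbedding (C.append D) (Fin.castAdd D.size) := by
  intro i
  refine ⟨id, fun j => rfl, ?_⟩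
  have : (C.gate i).map id = C.gate i := by cases C.gate i <;> simp [Gate.map]
  rw [this]
  exact dif_pos i.2

theorem isEmbedding_append_right (C D : Circuit n) :
    D.IsEmbedding (C.append D) (Fin.natAdd C.size) := by
  intro i
  refine ⟨fun j => ⟨C.size + j, by simp⟩, fun j => rfl, ?_⟩
  -- The index `C.size + i - C.size` equals `i` only propositionally; with a free `k` the equation
  -- can be substituted away.
  have key : ∀ (k : ℕ) (hk : k < D.size) (e : k = i)
      (hlt : ∀ j : Fin k, C.size + (j : ℕ) < C.size + i),
      (D.gate ⟨k, hk⟩).map (fun j : Fin k => (⟨C.size + j, hlt j⟩ : Fin (C.size + i)))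
        = (D.gate i).map fun j : Fin i => (⟨C.size + j, by simp⟩ : Fin (C.size + i)) := by
    rintro k hk rfl hlt
    rfl
  have h : ¬ ((Fin.natAdd C.size i : Fin (C.size + D.size)) : ℕ) < C.size := by simp
  refine (dif_neg h).trans (key _ _ ?_ _)
  simp

/-- The circuit `C` with one more gate, which becomes the output. -/
def snoc (C : Circuit n) (G : Gate n C.size) : Circuit n where
  size := C.size + 1
  gate i := if h : (i : ℕ) < C.size then C.gate ⟨i, h⟩
    else G.map fun j => ⟨j, by omega⟩
  output := Sum.inr (Fin.last C.size)

theorem isEmbedding_snoc (C : Circuit n) (G : Gate n C.size) :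
    C.IsEmbedding (C.snoc G) Fin.castSucc := by
  intro i
  refine ⟨id, fun j => rfl, ?_⟩
  have : (C.gate i).map id = C.gate i := by cases C.gate i <;> simp [Gate.map]
  rw [this]
  exact dif_pos i.2

theorem gate_snoc_last (C : Circuit n) (G : Gate n C.size) :
    (C.snoc G).gate (Fin.last C.size) = G.map id :=
  dif_neg (lt_irrefl C.size)

theorem eval_snoc (C : Circuit n) (G : Gate n C.size) (x : Fin n → Bool) :
    (C.snoc G).eval x = G.eval x (C.gateVal x) := by
  change (C.snoc G).gateVal x (Fin.last C.size) = _
  refine (gateVal.eq_1 (C.snoc G) x (Fin.last C.size)).trans ?_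
  rw [gate_snoc_last, Gate.eval_map]
  congr 1
  funext j
  exact (C.isEmbedding_snoc G).gateVal x j

theorem depth_snoc (C : Circuit n) (G : Gate n C.size) :
    (C.snoc G).depth = G.depth C.gateDepth := by
  change (C.snoc G).gateDepth (Fin.last C.size) = _
  refine (gateDepth.eq_1 (C.snoc G) (Fin.last C.size)).trans ?_
  rw [gate_snoc_last, Gate.depth_map]
  congr 1
  funext j
  exact (C.isEmbedding_snoc G).gateDepth j

end Circuit

/-! ### Closure properties of small circuits. -/

/-- `f` is computed by a circuit of size at most `s` and depth at most `d`. -/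
def HasCircuit {n : ℕ} (s d : ℕ) (f : (Fin n → Bool) → Bool) : Prop :=
  ∃ C : Circuit n, C.size ≤ s ∧ C.depth ≤ d ∧ C.Computes f

namespace HasCircuit

variable {n s d : ℕ} {f : (Fin n → Bool) → Bool}

theorem mono {s' d' : ℕ} (h : HasCircuit s d f) (hs : s ≤ s') (hd : d ≤ d') :
    HasCircuit s' d' f := by
  obtain ⟨C, h1, h2, h3⟩ := h
  exact ⟨C, h1.trans hs, h2.trans hd, h3⟩

theorem not (h : HasCircuit s d f) : HasCircuit (s + 1) (d + 1) fun x => !(f x) := by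
  obtain ⟨C, h1, h2, h3⟩ := h
  refine ⟨C.snoc (.not C.output), Nat.succ_le_succ h1, ?_, fun x => ?_⟩
  · rw [Circuit.depth_snoc]
    exact Nat.succ_le_succ h2
  · rw [Circuit.eval_snoc]
    exact congrArg Bool.not (h3 x)

/-- Finitely many functions with small circuits can be computed on wires of one circuit. -/
theorem exists_wires (l : List ((Fin n → Bool) → Bool)) (hl : ∀ f ∈ l, HasCircuit s d f) :
    ∃ (C : Circuit n) (S : Finset (Fin n ⊕ Fin C.size)), C.size ≤ l.length * s + 1 ∧
      (∀ w ∈ S, C.wireDepth w ≤ d) ∧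
      (∀ w ∈ S, ∃ f ∈ l, ∀ x, C.wireVal x w = f x) ∧
      (∀ f ∈ l, ∃ w ∈ S, ∀ x, C.wireVal x w = f x) := by
  classical
  induction l with
  | nil =>
    -- A circuit must have an output, and for `n = 0` only a gate can serve; this dummy gate is the
    -- `+ 1` in the size bound.
    exact ⟨⟨1, fun _ => .and ∅, Sum.inr 0⟩, ∅, by simp⟩
  | cons f l ih =>
    obtain ⟨C, S, h1, h2, h3, h4⟩ := ih fun g hg => hl g (List.mem_cons_of_mem _ hg)
    obtain ⟨D, k1, k2, k3⟩ := hl f List.mem_cons_self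
    have eL := C.isEmbedding_append_left D
    have eR := C.isEmbedding_append_right D
    have vR : ∀ x, (C.append D).wireVal x (Sum.map id (Fin.natAdd C.size) D.output) = f x :=
      fun x => (eR.wireVal x D.output).trans (k3 x)
    refine ⟨C.append D, insert (Sum.map id (Fin.natAdd C.size) D.output)
      (S.image (Sum.map id (Fin.castAdd D.size))), ?_, ?_, ?_, ?_⟩
    · change C.size + D.size ≤ _
      rw [List.length_cons, add_mul]
      omega
    · intro w hw
      rcases Finset.mem_insert.1 hw with rfl | hw
      · exact (eR.wireDepth D.output).trans_le k2
      · obtain ⟨v, hv, rfl⟩ := Finset.mem_image.1 hw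
        exact (eL.wireDepth v).trans_le (h2 v hv)
    · intro w hw
      rcases Finset.mem_insert.1 hw with rfl | hw
      · exact ⟨f, List.mem_cons_self, vR⟩
      · obtain ⟨v, hv, rfl⟩ := Finset.mem_image.1 hw
        obtain ⟨g, hg, hgv⟩ := h3 v hv
        exact ⟨g, List.mem_cons_of_mem _ hg, fun x => (eL.wireVal x v).trans (hgv x)⟩
    · intro g hg
      rcases List.mem_cons.1 hg with rfl | hg
      · exact ⟨_, Finset.mem_insert_self _ _, vR⟩
      · obtain ⟨v, hv, hgv⟩ := h4 g hg
        exact ⟨_, Finset.mem_insert_of_mem (Finset.mem_image_of_mem _ hv),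
          fun x => (eL.wireVal x v).trans (hgv x)⟩

theorem all {l : List ((Fin n → Bool) → Bool)} (hl : ∀ f ∈ l, HasCircuit s d f) :
    HasCircuit (l.length * s + 2) (d + 1) fun x => l.all fun f => f x := by
  obtain ⟨C, S, h1, h2, h3, h4⟩ := exists_wires l hl
  refine ⟨C.snoc (.and S), Nat.succ_le_succ h1, ?_, fun x => ?_⟩
  · rw [Circuit.depth_snoc]
    exact Nat.succ_le_succ (Finset.sup_le h2)
  · rw [Circuit.eval_snoc, Bool.eq_iff_iff]
    simp only [Gate.eval, decide_eq_true_eq, List.all_eq_true]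
    constructor
    · intro h f hf
      obtain ⟨w, hw, hwf⟩ := h4 f hf
      exact (hwf x).symm.trans (h w hw)
    · intro h w hw
      obtain ⟨f, hf, hwf⟩ := h3 w hw
      exact (hwf x).trans (h f hf)

theorem any {l : List ((Fin n → Bool) → Bool)} (hl : ∀ f ∈ l, HasCircuit s d f) :
    HasCircuit (l.length * s + 2) (d + 1) fun x => l.any fun f => f x := by
  obtain ⟨C, S, h1, h2, h3, h4⟩ := exists_wires l hl
  refine ⟨C.snoc (.or S), Nat.succ_le_succ h1, ?_, fun x => ?_⟩
  · rw [Circuit.depth_snoc]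
    exact Nat.succ_le_succ (Finset.sup_le h2)
  · rw [Circuit.eval_snoc, Bool.eq_iff_iff]
    simp only [Gate.eval, decide_eq_true_eq, List.any_eq_true]
    constructor
    · rintro ⟨w, hw, h⟩
      obtain ⟨f, hf, hwf⟩ := h3 w hw
      exact ⟨f, hf, (hwf x).symm.trans h⟩
    · rintro ⟨f, hf, h⟩
      obtain ⟨w, hw, hwf⟩ := h4 f hf
      exact ⟨w, hw, (hwf x).trans h⟩

theorem forall_fin {m : ℕ} {F : Fin m → (Fin n → Bool) → Bool}
    (hF : ∀ i, HasCircuit s d (F i)) :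
    HasCircuit (m * s + 2) (d + 1) fun x => decide (∀ i, F i x = true) := by
  have h := all (l := List.ofFn F) (s := s) (d := d) (by simpa [List.mem_ofFn] using hF)
  rw [List.length_ofFn] at h
  convert h using 2 with x
  rw [Bool.eq_iff_iff]
  simp

theorem exists_fin {m : ℕ} {F : Fin m → (Fin n → Bool) → Bool}
    (hF : ∀ i, HasCircuit s d (F i)) :
    HasCircuit (m * s + 2) (d + 1) fun x => decide (∃ i, F i x = true) := by
  have h := any (l := List.ofFn F) (s := s) (d := d) (by simpa [List.mem_ofFn] using hF)
  rw [List.length_ofFn] at h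
  convert h using 2 with x
  rw [Bool.eq_iff_iff]
  simp

/-- Disjunctive normal forms of small circuits have small circuits. -/
theorem dnf {k m : ℕ} {D : List (List ((Fin n → Bool) → Bool))} (hD : D.length ≤ k)
    (hl : ∀ l ∈ D, l.length ≤ m) (hf : ∀ l ∈ D, ∀ f ∈ l, HasCircuit s d f) :
    HasCircuit (k * (m * s + 2) + 2) (d + 2) fun x => D.any fun l => l.all fun f => f x := by
  have h := any (l := D.map fun l x => l.all fun f => f x) (s := m * s + 2) (d := d + 1) (by
    simp only [List.mem_map, forall_exists_index, and_imp, forall_apply_eq_imp_iff₂]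
    intro l hlD
    exact (all (hf l hlD)).mono (by gcongr; exact hl l hlD) le_rfl)
  rw [List.length_map] at h
  simp only [List.any_map, Function.comp_def] at h
  exact h.mono (by gcongr) le_rfl

end HasCircuit

/-! ### Uniform probability by counting. -/

/-- The proportion of the elements of a finite type that satisfy `P`. -/
noncomputable def density {α : Type*} (P : α → Prop) : ℝ :=
  (Nat.card {a // P a} : ℝ) / Nat.card α

theorem density_nonneg {α : Type*} (P : α → Prop) : 0 ≤ density P := by
  unfold density
  positivity

theorem density_not {α : Type*} [Finite α] [Nonempty α] (P : α → Prop) :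
    density (fun a => ¬ P a) = 1 - density P := by
  classical
  have h : Nat.card {a // P a} + Nat.card {a // ¬ P a} = Nat.card α := by
    rw [← Nat.card_sum, Nat.card_congr (Equiv.sumCompl P)]
  have h' : (Nat.card α : ℝ) ≠ 0 := Nat.cast_ne_zero.2 Nat.card_pos.ne'
  unfold density
  rw [← h] at h' ⊢
  push_cast at h' ⊢
  field_simp
  ring

theorem density_le_one {α : Type*} [Finite α] [Nonempty α] (P : α → Prop) : density P ≤ 1 := by
  linarith [density_not P, density_nonneg fun a => ¬ P a]

/-- Independence: a uniform function `ι → α` is a family of independent uniform samples. -/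
theorem density_forall {ι α : Type*} [Finite ι] [Finite α] (P : α → Prop) :
    density (fun g : ι → α => ∀ i, P (g i)) = density P ^ Nat.card ι := by
  unfold density
  rw [Nat.card_congr (Equiv.subtypePiEquivPi (p := fun _ : ι => P)), Nat.card_fun, Nat.card_fun,
    div_pow]
  push_cast
  rfl

theorem density_exists {ι α : Type*} [Finite ι] [Finite α] [Nonempty α] (P : α → Prop) :
    density (fun g : ι → α => ∃ i, P (g i)) = 1 - (1 - density P) ^ Nat.card ι := by
  rw [← density_not, ← density_forall, ← density_not]
  simp

theorem density_congr_equiv {α β : Type*} (e : α ≃ β) (P : β → Prop) :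
    density (fun a => P (e a)) = density P := by
  unfold density
  rw [Nat.card_congr e, Nat.card_congr (e.subtypeEquiv fun a => Iff.rfl)]

theorem density_prod_fst {α β : Type*} [Finite β] [Nonempty β] (P : α → Prop) :
    density (fun p : α × β => P p.1) = density P := by
  unfold density
  rw [Nat.card_congr (Equiv.prodSubtypeFstEquivSubtypeProd (p := P)), Nat.card_prod,
    Nat.card_prod]
  push_cast
  exact mul_div_mul_right _ _ (Nat.cast_ne_zero.2 Nat.card_pos.ne')

theorem density_prod_snd {α β : Type*} [Finite α] [Nonempty α] (P : β → Prop) :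
    density (fun p : α × β => P p.2) = density P :=
  (density_congr_equiv (Equiv.prodComm α β) fun p : β × α => P p.1).trans (density_prod_fst P)

theorem density_bool_prod {α : Type*} [Finite α] (P : Bool → α → Prop) :
    density (fun p : Bool × α => P p.1 p.2) = (density (P true) + density (P false)) / 2 := by
  unfold density
  rw [Nat.card_congr (Equiv.subtypeProdEquivSigmaSubtype P), Nat.card_sigma, Nat.card_prod,
    Fintype.sum_bool, Nat.card_eq_fintype_card (α := Bool), Fintype.card_bool]
  push_cast
  rw [← add_div, div_div, mul_comm]

/-- Union bound: if for every `x` the property `P x` fails with density less than `1 / |X|`, then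
some `a` has all these properties. -/
theorem exists_forall_of_density {X α : Type*} [Finite X] [Finite α] [Nonempty α]
    (P : X → α → Prop)
    (h : ∀ x, density (fun a => ¬ P x a) * Nat.card X < 1) : ∃ a, ∀ x, P x a := by
  classical
  by_contra! hcon
  have := Fintype.ofFinite X
  have := Fintype.ofFinite α
  have hα : (0 : ℝ) < Nat.card α := Nat.cast_pos.2 Nat.card_pos
  -- Pairing every `a` with an `x` at which it fails injects `α` into the disjoint union of the
  -- failure sets.
  have hle : Nat.card α ≤ ∑ x, Nat.card {a // ¬ P x a} := by
    rw [← Nat.card_sigma]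
    choose g hg using hcon
    exact Nat.card_le_card_of_injective (fun a => (⟨g a, a, hg a⟩ : Σ x, {a // ¬ P x a}))
      fun a b hab => congrArg (fun p : Σ x, {a // ¬ P x a} => (p.2 : α)) hab
  have hX : Nonempty X := ⟨(hcon (Classical.arbitrary α)).choose⟩
  have hlt : ∑ x : X, density (fun a => ¬ P x a) < ∑ _x : X, (1 : ℝ) / Nat.card X :=
    Finset.sum_lt_sum_of_nonempty Finset.univ_nonempty fun x _ => by
      rw [lt_div_iff₀ (Nat.cast_pos.2 Nat.card_pos)]
      exact h x
  rw [Finset.sum_const, Finset.card_univ, nsmul_eq_mul, ← Nat.card_eq_fintype_card,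
    mul_one_div_cancel (Nat.cast_ne_zero.2 Nat.card_pos.ne')] at hlt
  unfold density at hlt
  rw [← Finset.sum_div, div_lt_one hα] at hlt
  exact absurd hlt (not_lt.2 (by exact_mod_cast hle))

/-! ### Randomized trees as mixtures of DNFs. -/

namespace RMDTree

variable {n : ℕ}

/-- A randomized tree is a uniform mixture of disjunctive normal forms, whose literals are
queries and negated queries. -/
theorem exists_dnf_family {s d : ℕ} (T : RMDTree n) (hT : ∀ q ∈ T.queries, HasCircuit s d q) :
    ∃ (Ω : Type) (_ : Finite Ω) (_ : Nonempty Ω) (D : Ω → List (List ((Fin n → Bool) → Bool))),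
      (∀ ω, (D ω).length ≤ 2 ^ T.height) ∧
      (∀ ω, ∀ l ∈ D ω, l.length ≤ T.height) ∧
      (∀ ω, ∀ l ∈ D ω, ∀ f ∈ l, HasCircuit (s + 1) (d + 1) f) ∧
      ∀ x b, (T.outcome x b).toReal =
        density fun ω => ((D ω).any fun l => l.all fun f => f x) = b := by
  induction T with
  | leaf b =>
    refine ⟨Unit, inferInstance, inferInstance, fun _ => if b then [[]] else [], ?_, ?_, ?_, ?_⟩
    · cases b <;> simp [height]
    · cases b <;> simp [height]
    · cases b <;> simp
    · intro x c
      cases b <;> cases c <;> simp [outcome, density]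
  | query q hq t₀ t₁ ih₀ ih₁ =>
    obtain ⟨Ω₀, _, _, D₀, a₀, b₀, c₀, e₀⟩ := ih₀ fun r hr => hT r (by simp [queries, hr])
    obtain ⟨Ω₁, _, _, D₁, a₁, b₁, c₁, e₁⟩ := ih₁ fun r hr => hT r (by simp [queries, hr])
    have hqc : HasCircuit s d q := hT q (by simp [queries])
    -- Both subtrees draw their coins in advance. On a given input, the terms of the branch not
    -- taken contain a false literal, so only one coordinate of `ω` matters.
    refine ⟨Ω₀ × Ω₁, inferInstance, inferInstance, fun ω =>
      (D₀ ω.1).map (List.cons fun x => !(q x)) ++ (D₁ ω.2).map (List.cons q), ?_, ?_, ?_, ?_⟩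
    · intro ω
      rw [List.length_append, List.length_map, List.length_map, height, pow_succ, mul_two]
      exact add_le_add
        ((a₀ _).trans (Nat.pow_le_pow_right two_pos (le_max_left _ _)))
        ((a₁ _).trans (Nat.pow_le_pow_right two_pos (le_max_right _ _)))
    · intro ω l hl
      rcases List.mem_append.1 hl with hl | hl
      · obtain ⟨l', hl', rfl⟩ := List.mem_map.1 hl
        exact Nat.succ_le_succ ((b₀ _ l' hl').trans (le_max_left _ _))
      · obtain ⟨l', hl', rfl⟩ := List.mem_map.1 hl
        exact Nat.succ_le_succ ((b₁ _ l' hl').trans (le_max_right _ _))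
    · intro ω l hl f hf
      rcases List.mem_append.1 hl with hl | hl
      · obtain ⟨l', hl', rfl⟩ := List.mem_map.1 hl
        rcases List.mem_cons.1 hf with rfl | hf
        · exact hqc.not
        · exact c₀ _ l' hl' f hf
      · obtain ⟨l', hl', rfl⟩ := List.mem_map.1 hl
        rcases List.mem_cons.1 hf with rfl | hf
        · exact hqc.mono (Nat.le_succ s) (Nat.le_succ d)
        · exact c₁ _ l' hl' f hf
    · intro x b
      have hfalse : ∀ D : List (List ((Fin n → Bool) → Bool)), (D.any fun _ => false) = false := by
        simp
      cases hx : q x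
      · simpa [outcome, hx, hfalse, Function.comp_def] using
          (e₀ x b).trans (density_prod_fst (β := Ω₁) _).symm
      · simpa [outcome, hx, hfalse, Function.comp_def] using
          (e₁ x b).trans (density_prod_snd (α := Ω₀) _).symm
  | random t₀ t₁ ih₀ ih₁ =>
    obtain ⟨Ω₀, _, _, D₀, a₀, b₀, c₀, e₀⟩ := ih₀ fun r hr => hT r (by simp [queries, hr])
    obtain ⟨Ω₁, _, _, D₁, a₁, b₁, c₁, e₁⟩ := ih₁ fun r hr => hT r (by simp [queries, hr])
    -- The product, unlike a disjoint union, gives both outcomes of the coin equal weight even when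
    -- `Ω₀` and `Ω₁` differ in size.
    refine ⟨Bool × (Ω₀ × Ω₁), inferInstance, inferInstance,
      fun ω => if ω.1 = true then D₁ ω.2.2 else D₀ ω.2.1, ?_, ?_, ?_, ?_⟩
    · rintro ⟨_ | _, ω₀, ω₁⟩
      · exact (a₀ _).trans (Nat.pow_le_pow_right two_pos ((le_max_left _ _).trans (Nat.le_succ _)))
      · exact (a₁ _).trans (Nat.pow_le_pow_right two_pos ((le_max_right _ _).trans (Nat.le_succ _)))
    · rintro ⟨_ | _, ω₀, ω₁⟩ l hl
      · exact (b₀ _ l hl).trans ((le_max_left _ _).trans (Nat.le_succ _))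
      · exact (b₁ _ l hl).trans ((le_max_right _ _).trans (Nat.le_succ _))
    · rintro ⟨_ | _, ω₀, ω₁⟩ l hl
      · exact c₀ _ l hl
      · exact c₁ _ l hl
    · intro x b
      have key := density_bool_prod fun (r : Bool) (ω : Ω₀ × Ω₁) =>
        ((if r = true then D₁ ω.2 else D₀ ω.1).any fun l => l.all fun f => f x) = b
      refine Eq.trans ?_ key.symm
      have k₀ := (e₀ x b).trans (density_prod_fst (β := Ω₁) _).symm
      have k₁ := (e₁ x b).trans (density_prod_snd (α := Ω₀) _).symm
      simp only [if_true, Bool.false_eq_true, if_false]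
      rw [← k₀, ← k₁, outcome, PMF.bind_apply, tsum_bool]
      simp only [PMF.uniformOfFintype_apply, Fintype.card_bool, if_true, Bool.false_eq_true,
        if_false]
      rw [ENNReal.toReal_add
        (ENNReal.mul_ne_top (by simp) (PMF.apply_ne_top _ _))
        (ENNReal.mul_ne_top (by simp) (PMF.apply_ne_top _ _)), ENNReal.toReal_mul,
        ENNReal.toReal_mul]
      simp
      ring

end RMDTree

/-! ### Approximate majority. -/

theorem density_forall_exists_forall {α : Type*} [Finite α] [Nonempty α] (P : α → Prop)
    (a b c : ℕ) :
    density (fun g : Fin c → Fin b → Fin a → α => ∀ i, ∃ j, ∀ k, P (g i j k)) =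
      (1 - (1 - density P ^ a) ^ b) ^ c := by
  rw [density_forall fun g : Fin b → Fin a → α => ∃ j, ∀ k, P (g j k),
    density_exists fun g : Fin a → α => ∀ k, P (g k), density_forall P]
  simp

/-- By Bernoulli's inequality, an OR of ANDs accepts with probability at most `(2 * p) ^ t ≤ (2 / 3)
^ 2 < 1 / 2`, and all `n + 1` independent ones must accept. -/
theorem amplify_of_le_third {p : ℝ} (h0 : 0 ≤ p) (h1 : p ≤ 1 / 3) {t : ℕ} (ht : 2 ≤ t) (n : ℕ) :
    (1 - (1 - p ^ t) ^ 2 ^ t) ^ (n + 1) * 2 ^ n < 1 := by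
  have hp1 : p ^ t ≤ 1 := pow_le_one₀ h0 (by linarith)
  have hbern := one_add_mul_le_pow (a := -p ^ t) (by linarith) (2 ^ t)
  have hsmall : 2 ^ t * p ^ t ≤ (1 / 2 : ℝ) := by
    rw [← mul_pow]
    calc (2 * p) ^ t ≤ (2 / 3 : ℝ) ^ t := by gcongr; linarith
      _ ≤ (2 / 3 : ℝ) ^ 2 := pow_le_pow_of_le_one (by norm_num) (by norm_num) ht
      _ ≤ 1 / 2 := by norm_num
  have hle : 1 - (1 - p ^ t) ^ 2 ^ t ≤ (1 / 2 : ℝ) := by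
    push_cast at hbern
    rw [← sub_eq_add_neg 1 (p ^ t)] at hbern
    linarith
  have hge : 0 ≤ 1 - (1 - p ^ t) ^ 2 ^ t :=
    sub_nonneg.2 (pow_le_one₀ (by linarith) (by linarith [pow_nonneg h0 t]))
  calc (1 - (1 - p ^ t) ^ 2 ^ t) ^ (n + 1) * 2 ^ n
      ≤ (1 / 2 : ℝ) ^ (n + 1) * 2 ^ n := by gcongr
    _ = 1 / 2 := by
      rw [pow_succ, mul_right_comm, ← mul_pow]
      norm_num
    _ < 1 := by norm_num

/-- An OR of ANDs rejects with probability at most `exp (-(2 * p) ^ t) ≤ 2 ^ (-(2 * n + 1))`. The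
union over `n + 1 ≤ 2 ^ n` ORs and the factor `2 ^ n` for the inputs still leave `1 / 2`. -/
theorem amplify_of_two_thirds_le {p : ℝ} (h0 : 2 / 3 ≤ p) (h1 : p ≤ 1) {t n : ℕ}
    (ht : (2 * n + 1 : ℝ) ≤ (4 / 3) ^ t) :
    (1 - (1 - (1 - p ^ t) ^ 2 ^ t) ^ (n + 1)) * 2 ^ n < 1 := by
  have hp1 : p ^ t ≤ 1 := pow_le_one₀ (by linarith) h1
  set e := (1 - p ^ t) ^ 2 ^ t with he
  have he0 : 0 ≤ e := pow_nonneg (by linarith) _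
  have he1 : e ≤ (1 / 2) ^ (2 * n + 1) := by
    calc e ≤ Real.exp (-p ^ t) ^ 2 ^ t := by
          rw [he]
          gcongr
          linarith [Real.add_one_le_exp (-p ^ t)]
      _ = Real.exp (-((2 * p) ^ t)) := by
          rw [← Real.exp_nat_mul, mul_pow]
          push_cast
          ring_nf
      _ ≤ Real.exp (-((2 * n + 1 : ℕ) : ℝ)) := by
          rw [Real.exp_le_exp, neg_le_neg_iff]
          push_cast
          refine ht.trans ?_
          gcongr
          linarith
      _ = Real.exp (-1) ^ (2 * n + 1) := by
          rw [← Real.exp_nat_mul]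
          ring_nf
      _ ≤ (1 / 2) ^ (2 * n + 1) := by
          gcongr
          rw [Real.exp_neg, one_div]
          gcongr
          linarith [Real.add_one_le_exp 1]
  have he2 : e ≤ 1 := he1.trans (pow_le_one₀ (by norm_num) (by norm_num))
  have hbern := one_add_mul_le_pow (a := -e) (by linarith) (n + 1)
  rw [← sub_eq_add_neg 1 e] at hbern
  push_cast at hbern
  have hn : (n + 1 : ℝ) ≤ 2 ^ n := by exact_mod_cast Nat.lt_two_pow_self (n := n)
  calc (1 - (1 - e) ^ (n + 1)) * 2 ^ n ≤ ((n + 1) * e) * 2 ^ n := by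
        gcongr
        linarith
    _ ≤ (2 ^ n * (1 / 2) ^ (2 * n + 1)) * 2 ^ n := by gcongr
    _ = 1 / 2 := by
        rw [pow_succ, pow_mul, mul_right_comm, ← mul_pow, ← mul_assoc, ← mul_pow]
        norm_num
    _ < 1 := by norm_num

/-- Approximate majority: if for every `x` at least two thirds of the `F ω` agree with `f` at `x`,
then `f` is an AND of ORs of ANDs of few of the functions `F ω`. -/
theorem exists_samples {n t : ℕ} {Ω : Type} [Finite Ω] [Nonempty Ω]
    (F : Ω → (Fin n → Bool) → Bool) (f : (Fin n → Bool) → Bool)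
    (hF : ∀ x, 2 / 3 ≤ density fun ω => F ω x = f x)
    (ht : 2 ≤ t) (htn : (2 * n + 1 : ℝ) ≤ (4 / 3) ^ t) :
    ∃ g : Fin (n + 1) → Fin (2 ^ t) → Fin t → Ω,
      ∀ x, (∀ i, ∃ j, ∀ k, F (g i j k) x = true) ↔ f x = true := by
  refine exists_forall_of_density
    (fun x (g : Fin (n + 1) → Fin (2 ^ t) → Fin t → Ω) =>
      (∀ i, ∃ j, ∀ k, F (g i j k) x = true) ↔ f x = true) fun x => ?_
  have hcard : (Nat.card (Fin n → Bool) : ℝ) = 2 ^ n := by simp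
  rw [hcard]
  have hx := hF x
  cases hfx : f x
  · simp only [Bool.false_eq_true, iff_false, not_not]
    rw [density_forall_exists_forall fun ω => F ω x = true]
    refine amplify_of_le_third (density_nonneg _) ?_ ht n
    have hnot := density_not fun ω => F ω x = true
    simp only [Bool.not_eq_true] at hnot
    rw [hfx] at hx
    linarith
  · simp only [iff_true]
    rw [density_not fun g : Fin (n + 1) → Fin (2 ^ t) → Fin t → Ω =>
      ∀ i, ∃ j, ∀ k, F (g i j k) x = true, density_forall_exists_forall fun ω => F ω x = true]
    rw [hfx] at hx
    exact amplify_of_two_thirds_le hx (density_le_one _) htn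

/-! ### Polynomial bounds and assembly. -/

theorem exists_sample_size (n : ℕ) :
    ∃ t : ℕ, 2 ≤ t ∧ (2 * n + 1 : ℝ) ≤ (4 / 3) ^ t ∧ 2 ^ t ≤ (2 * (2 * n + 1)) ^ 3 := by
  -- The factor 3 is chosen because `(4 / 3) ^ 3 = 64 / 27 ≥ 2`.
  refine ⟨3 * (Nat.log 2 (2 * n + 1) + 1), by omega, ?_, ?_⟩
  · have h : 2 * n + 1 ≤ 2 ^ (Nat.log 2 (2 * n + 1) + 1) :=
      (Nat.lt_pow_succ_log_self one_lt_two _).le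
    have h' : (2 * n + 1 : ℝ) ≤ 2 ^ (Nat.log 2 (2 * n + 1) + 1) := by exact_mod_cast h
    rw [pow_mul]
    refine h'.trans ?_
    gcongr
    norm_num
  · rw [mul_comm 3, pow_mul, pow_succ 2 (Nat.log _ _), mul_comm _ 2]
    gcongr
    exact Nat.pow_log_le_self 2 (Nat.succ_ne_zero _)

theorem exists_polynomial_two_pow_le {h : ℕ → ℕ}
    (hh : (fun n : ℕ => (h n : ℝ)) =O[Filter.atTop] fun n : ℕ => Real.log n) :
    ∃ p : Polynomial ℕ, ∀ n, 2 ^ h n ≤ p.eval n := by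
  obtain ⟨K, hK⟩ := hh.bound
  obtain ⟨m, hm⟩ := exists_nat_ge K
  obtain ⟨N, hN⟩ := Filter.eventually_atTop.1 (hK.and (Filter.eventually_ge_atTop 1))
  -- The constant term absorbs the finitely many `n` not covered by the asymptotic bound.
  refine ⟨Polynomial.X ^ m + Polynomial.C (∑ i ∈ Finset.range N, 2 ^ h i), fun n => ?_⟩
  simp only [Polynomial.eval_add, Polynomial.eval_pow, Polynomial.eval_X, Polynomial.eval_C]
  by_cases hn : n < N
  · exact (Finset.single_le_sum (f := fun i => 2 ^ h i) (fun _ _ => Nat.zero_le _)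
      (Finset.mem_range.2 hn)).trans (Nat.le_add_left _ _)
  · obtain ⟨hb, hn1⟩ := hN n (not_lt.1 hn)
    refine le_trans ?_ (Nat.le_add_right _ _)
    have hn1' : (1 : ℝ) ≤ n := by exact_mod_cast hn1
    have hlog : 0 ≤ Real.log n := Real.log_nonneg hn1'
    rw [Real.norm_of_nonneg (Nat.cast_nonneg _), Real.norm_of_nonneg hlog] at hb
    have key : (2 : ℝ) ^ h n ≤ (n : ℝ) ^ m := by
      calc (2 : ℝ) ^ h n ≤ Real.exp 1 ^ h n := by
            gcongr
            linarith [Real.add_one_le_exp 1]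
        _ = Real.exp (h n) := by rw [← Real.exp_nat_mul, mul_one]
        _ ≤ Real.exp (m * Real.log n) := by
            rw [Real.exp_le_exp]
            exact hb.trans (mul_le_mul_of_nonneg_right hm hlog)
        _ = (n : ℝ) ^ m := by rw [Real.exp_nat_mul, Real.exp_log (by linarith)]
    exact_mod_cast key

/-- A function with a randomized decision tree whose queries have small circuits has a circuit
whose size is polynomial in the size of these circuits and exponential in the height. -/
theorem RMDTree.Computes.hasCircuit {n s d : ℕ} {T : RMDTree n} {f : (Fin n → Bool) → Bool}
    (hTf : T.Computes f) (hT : ∀ q ∈ T.queries, HasCircuit s d q) :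
    HasCircuit ((n + 1) * ((2 * (2 * n + 1)) ^ 3 * ((2 * (2 * n + 1)) ^ 3 *
      (2 ^ T.height * (2 ^ T.height * (s + 1) + 2) + 2) + 2) + 2) + 2) (d + 6) f := by
  obtain ⟨Ω, _, _, D, h1, h2, h3, h4⟩ := T.exists_dnf_family hT
  obtain ⟨t, ht, htn, htb⟩ := exists_sample_size n
  obtain ⟨g, hg⟩ := exists_samples (fun ω x => (D ω).any fun l => l.all fun q => q x) f
    (fun x => by
      rw [← h4 x (f x)]
      have := ENNReal.toReal_mono (PMF.apply_ne_top _ _) (hTf x)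
      simpa using this) ht htn
  have hD : ∀ ω, HasCircuit (2 ^ T.height * (2 ^ T.height * (s + 1) + 2) + 2) (d + 3)
      fun x => (D ω).any fun l => l.all fun q => q x := fun ω =>
    -- Term length is bounded crudely by `2 ^ T.height`, so that a single polynomial will control
    -- both dimensions of the DNF.
    HasCircuit.dnf (h1 ω) (fun l hl => (h2 ω l hl).trans Nat.lt_two_pow_self.le) (h3 ω)
  have hC := HasCircuit.forall_fin fun i => HasCircuit.exists_fin fun j =>
    HasCircuit.forall_fin fun k => hD (g i j k)
  simp only [decide_eq_true_eq] at hC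
  have hf : (fun x => decide (∀ i, ∃ j, ∀ k,
      ((D (g i j k)).any fun l => l.all fun q => q x) = true)) = f := by
    funext x
    rw [Bool.eq_iff_iff, decide_eq_true_eq]
    exact hg x
  rw [hf] at hC
  refine hC.mono ?_ le_rfl
  gcongr
  exact Nat.lt_two_pow_self.le.trans htb

theorem mainTheorem7 : RMDT_AC0 ⊆ AC0 := by
  rintro f ⟨T, hTf, hh, p, d, hq⟩
  obtain ⟨H, hH⟩ := exists_polynomial_two_pow_le hh
  refine ⟨(.X + 1) * ((2 * (2 * .X + 1)) ^ 3 * ((2 * (2 * .X + 1)) ^ 3 *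
    (H * (H * (p + 1) + 2) + 2) + 2) + 2) + 2, d + 6, fun n => ?_⟩
  have hC := (hTf n).hasCircuit fun q hqn => (hq n q hqn).imp fun C hC => hC.2
  refine hC.mono ?_ le_rfl
  simp only [Polynomial.eval_add, Polynomial.eval_mul, Polynomial.eval_pow, Polynomial.eval_X,
    Polynomial.eval_one, Polynomial.eval_ofNat]
  have := hH n
  gcongr
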